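/- Let $(X,d)$ be a Polish metric space (a complete separable metric space), let $a,b>0$, and let $\mathcal M(X)$ be the set of finite nonnegative Borel measures on $X$; write $|\mu|=\mu(X)$ for the mass of $\mu\in\mathcal M(X)$ and $|\mu-\nu|$ for the total variation norm of the signed measure $\mu-\nu$. Let $\mathcal M_1(X)$ be the set of $\mu\in\mathcal M(X)$ with $\int_X d(x,x_0)\,d\mu(x)<\infty$ for every (equivalently, when $X\neq\emptyset$, for some) $x_0\in X$. For $\mu,\nu\in\mathcal M_1(X)$ with $|\mu|=|\nu|$ put $$W_1(\mu,\nu)=|\mu|\,\inf_{\pi\in\Pi(\mu,\nu)}\int_{X\times X}d(x,y)\,d\pi(x,y),$$ where $\Pi(\mu,\nu)$ is the set of Borel probability measures $\pi$ on $X\times X$ with $|\mu|\,\pi(A\times X)=\mu(A)$ and $|\nu|\,\pi(X\times B)=\nu(B)$ for all Borel sets $A,B\subseteq X$ (and $W_1(0,0)=0$). For $\mu_1,\mu_2\in\mathcal M(X)$ the generalized Wasserstein distance is $$W_1^{a,b}(\mu_1,\mu_2)=\inf\bigl\{a|\mu_1-\tilde\mu_1|+a|\mu_2-\tilde\mu_2|+b\,W_1(\tilde\mu_1,\tilde\mu_2)\;:\;\tilde\mu_1,\tilde\mu_2\in\mathcal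 M_1(X),\ |\tilde\mu_1|=|\tilde\mu_2|\bigr\}.$$ For $t\in\mathbb R$ let $I(t)=\inf_{s\ge 0}\bigl(st+a|1-s|\bigr)\in[-\infty,\infty)$, and let $$\Phi_W=\bigl\{(\varphi_1,\varphi_2)\in C_b(X)\times C_b(X)\;:\;\varphi_1(x)+\varphi_2(y)\le b\,d(x,y)\ \text{and}\ \varphi_1(x),\varphi_2(y)\ge -a\ \text{for all }x,y\in X\bigr\}.$$ **Theorem (Kantorovich duality for $W_1^{a,b}$).** For all $\mu_1,\mu_2\in\mathcal M(X)$, $$W_1^{a,b}(\mu_1,\mu_2)=\sup_{(\varphi_1,\varphi_2)\in\Phi_W}\ \sum_{i=1}^{2}\int_X I(\varphi_i(x))\,d\mu_i(x),$$ where the left-hand side is finite and, for every $(\varphi_1,\varphi_2)\in\Phi_W$, the functions $I\circ\varphi_i$ are real-valued and $\mu_i$-integrable. -/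

import Mathlib

open MeasureTheory Set
open scoped ENNReal NNReal BoundedContinuousFunction

noncomputable section

namespace GenWasserstein

/-- `|μ - ν|`: the total mass of the total variation of the signed measure `μ - ν`. -/
def tvNorm {X : Type*} [MeasurableSpace X] (μ ν : FiniteMeasure X) : ℝ≥0∞ :=
  ((μ : Measure X).toSignedMeasure - (ν : Measure X).toSignedMeasure).totalVariation univ

/-- `μ ∈ ℳ_p(X)`: the finite measure `μ` has a finite `p`-moment. For a finite measure and `1 ≤ p`
the moment about one point is finite iff it is finite about every point; with `∀`, the zero measure
on the empty space also belongs to `ℳ_p`. -/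
def HasFiniteMoment {X : Type*} [MetricSpace X] [MeasurableSpace X]
    (p : ℝ) (μ : FiniteMeasure X) : Prop :=
  ∀ x₀ : X, ∫⁻ x, edist x x₀ ^ p ∂(μ : Measure X) < ∞

/-- `Π(μ, ν)`: the transference plans between `μ` and `ν`, i.e. the Borel probability measures `π`
on `X × X` with `|μ| π(A × X) = μ(A)` and `|ν| π(X × B) = ν(B)` for all Borel `A`, `B`. -/
def transferencePlans {X : Type*} [MeasurableSpace X] (μ ν : FiniteMeasure X) :
    Set (ProbabilityMeasure (X × X)) :=
  {π | (∀ A : Set X, MeasurableSet A →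
          (μ : Measure X) univ * (π : Measure (X × X)) (A ×ˢ univ) = (μ : Measure X) A) ∧
       (∀ B : Set X, MeasurableSet B →
          (ν : Measure X) univ * (π : Measure (X × X)) (univ ×ˢ B) = (ν : Measure X) B)}

/-- The transport cost `J_p(π) = ∫ d(x,y)^p dπ(x,y)`. -/
def transportCost {X : Type*} [MetricSpace X] [MeasurableSpace X]
    (p : ℝ) (π : ProbabilityMeasure (X × X)) : ℝ≥0∞ :=
  ∫⁻ z, edist z.1 z.2 ^ p ∂(π : Measure (X × X))

/-- The Wasserstein distance `W_p(μ, ν) = (|μ| inf_{π ∈ Π(μ, ν)} J_p(π))^{1/p}`, used for measures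
of equal mass. -/
def wasserstein {X : Type*} [MetricSpace X] [MeasurableSpace X]
    (p : ℝ) (μ ν : FiniteMeasure X) : ℝ≥0∞ :=
  ((μ : Measure X) univ * ⨅ π ∈ transferencePlans μ ν, transportCost p π) ^ (1 / p)

/-- The generalized Wasserstein distance `W_p^{a,b}(μ, ν)`: the infimum of
`a |μ - μ'| + a |ν - ν'| + b W_p(μ', ν')` over `μ', ν' ∈ ℳ_p(X)` of equal mass. -/
def genWasserstein {X : Type*} [MetricSpace X] [MeasurableSpace X]
    (p a b : ℝ) (μ ν : FiniteMeasure X) : ℝ≥0∞ :=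
  ⨅ (μ' : FiniteMeasure X) (ν' : FiniteMeasure X)
    (_ : HasFiniteMoment p μ') (_ : HasFiniteMoment p ν')
    (_ : (μ' : Measure X) univ = (ν' : Measure X) univ),
    ENNReal.ofReal a * tvNorm μ μ' + ENNReal.ofReal a * tvNorm ν ν'
      + ENNReal.ofReal b * wasserstein p μ' ν'

/-- `I(t) = inf_{s ≥ 0} (s t + a |1 - s|)`, an extended real (it is `-∞` for `t < -a`). -/
def dualEntropy (a t : ℝ) : EReal :=
  ⨅ s : ℝ≥0, (((s : ℝ) * t + a * |1 - (s : ℝ)| : ℝ) : EReal)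

/-- `Φ_W`: the pairs of bounded continuous functions with `φ₁(x) + φ₂(y) ≤ b d(x,y)` and
`φ₁(x), φ₂(y) ≥ -a` for all `x`, `y`. -/
def dualPairs (X : Type*) [MetricSpace X] (a b : ℝ) : Set ((X →ᵇ ℝ) × (X →ᵇ ℝ)) :=
  {φ | ∀ x y : X, φ.1 x + φ.2 y ≤ b * dist x y ∧ -a ≤ φ.1 x ∧ -a ≤ φ.2 y}

/-- `∑ᵢ ∫ I(φᵢ(x)) dμᵢ(x)`. -/
def dualValue {X : Type*} [MetricSpace X] [MeasurableSpace X]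
    (a : ℝ) (μ₁ μ₂ : FiniteMeasure X) (φ : (X →ᵇ ℝ) × (X →ᵇ ℝ)) : ℝ :=
  ∫ x, (dualEntropy a (φ.1 x)).toReal ∂(μ₁ : Measure X)
    + ∫ x, (dualEntropy a (φ.2 x)).toReal ∂(μ₂ : Measure X)

end GenWasserstein

end

/-!
The proof compares the primal and the dual problem on finitely many points.

Weak duality (`ofReal_dualValue_le_genWasserstein`): for `t ≥ -a` one has `I(t) = min t a`, so along an
admissible pair `|I ∘ φᵢ| ≤ a`. Replacing `μᵢ` by `μᵢ'` hence costs at most `a |μᵢ - μᵢ'|`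
(`integral_sub_integral_le_tvNorm`), and `∫ φ₁ dμ₁' + ∫ φ₂ dμ₂'` is at most `b W₁(μ₁', μ₂')` by
integrating `φ₁(x) + φ₂(y) ≤ b d(x, y)` against a transference plan.

Strong duality (`exists_dualPair_genWasserstein_le`): fix `δ > 0`. By tightness, up to mass `δ` both
measures live on finitely many disjoint cells `A j` contained in balls of radius `δ` about points `x j`
(`exists_disjoint_cells`). Consider the finite problem with the weights `μᵢ (A j)`, the cost
`b (d(x j, x k) + 2 δ)`, and the penalty `a` per unit of violated marginal (`relaxedCost`).
* A finite plan spreads over the cells to a competitor in the original problem, and the `2 δ` in the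
  cost covers the error made in doing so (`genWasserstein_le_relaxedCost`).
* The optimal value of the finite problem is sublinear in the weights, so the Hahn-Banach theorem
  provides a linear functional that is dominated by it and agrees with it at the given weights. The
  coordinates of this functional are optimal potentials, with values in `[-a, a]` because of the
  penalty (`exists_potentials`).
* The cut-off `c`-transform of one potential is a `b`-Lipschitz function `F` on `X` with values in
  `[-a, a]` (`exists_lipschitz_extension`), and `(F, -F)` is an admissible pair whose dual value is at
  least that of the finite problem, up to `O(δ)` (`sum_mul_le_integral`).

Letting `δ` tend to `0` closes the gap.
-/

namespace GenWasserstein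

/-! ### The entropy `I` -/

theorem dualEntropy_of_neg_le {a t : ℝ} (ht : -a ≤ t) :
    dualEntropy a t = ((min t a : ℝ) : EReal) := by
  apply le_antisymm
  -- the infimum is attained at `s = 1` for `t ≤ a` and at `s = 0` otherwise
  · rcases le_total t a with h | h
    · refine (iInf_le _ (1 : ℝ≥0)).trans ?_
      simp [h]
    · refine (iInf_le _ (0 : ℝ≥0)).trans ?_
      simp [h]
  · refine le_iInf fun s => ?_
    rw [EReal.coe_le_coe_iff]
    have hs : (0 : ℝ) ≤ s := s.2
    rcases le_total (1 : ℝ) s with h1 | h1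
    · rw [abs_of_nonpos (by linarith)]
      nlinarith [min_le_left t a]
    · rw [abs_of_nonneg (by linarith)]
      nlinarith [min_le_left t a, min_le_right t a]

theorem toReal_dualEntropy {a t : ℝ} (ht : -a ≤ t) :
    (dualEntropy a t).toReal = min t a := by
  rw [dualEntropy_of_neg_le ht, EReal.toReal_coe]

/-! ### Total variation -/

section TotalVariation

variable {X : Type*} [MeasurableSpace X]

theorem tvNorm_eq_sub_add_sub (μ ν : FiniteMeasure X) :
    tvNorm μ ν = ((μ : Measure X) - ν) univ + ((ν : Measure X) - μ) univ := by
  rw [tvNorm, SignedMeasure.totalVariation, Measure.toJordanDecomposition_toSignedMeasure_sub]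
  rfl

theorem tvNorm_ne_top (μ ν : FiniteMeasure X) : tvNorm μ ν ≠ ∞ := by
  rw [tvNorm_eq_sub_add_sub]
  exact ENNReal.add_ne_top.2 ⟨measure_ne_top _ _, measure_ne_top _ _⟩

/-- No factor `2` appears because `μ - ν` and `ν - μ` are mutually singular. -/
theorem tvNorm_le_of_le_add {μ ν : FiniteMeasure X} {ξ : Measure X}
    (h₁ : (μ : Measure X) ≤ ξ + ν) (h₂ : (ν : Measure X) ≤ ξ + μ) : tvNorm μ ν ≤ ξ univ := by
  rw [tvNorm_eq_sub_add_sub]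
  obtain ⟨s, hs, hs₁, hs₂⟩ :=
    Measure.mutually_singular_measure_sub (μ := (μ : Measure X)) (ν := (ν : Measure X))
  rw [← measure_add_measure_compl hs (μ := (μ : Measure X) - (ν : Measure X)),
    ← measure_add_measure_compl hs (μ := (ν : Measure X) - (μ : Measure X)), hs₁, hs₂, zero_add, add_zero,
    add_comm, ← measure_add_measure_compl hs (μ := ξ)]
  exact add_le_add (Measure.sub_le_of_le_add h₂ s) (Measure.sub_le_of_le_add h₁ sᶜ)

/-- Both sides are the supremum of `μ` and `ν`; this is the Jordan decomposition of `μ - ν` stated without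
signed measures. -/
theorem add_sub_comm_measure (μ ν : FiniteMeasure X) :
    (μ : Measure X) + ((ν : Measure X) - μ) = ν + ((μ : Measure X) - ν) := by
  have h := Measure.sub_toSignedMeasure_eq_toSignedMeasure_sub
    (μ := (μ : Measure X)) (ν := (ν : Measure X))
  rw [← Measure.toSignedMeasure_eq_toSignedMeasure_iff, Measure.toSignedMeasure_add,
    Measure.toSignedMeasure_add]
  rw [sub_eq_sub_iff_add_eq_add] at h
  rw [h, add_comm]

theorem integral_sub_integral_le_tvNorm {a : ℝ} (μ ν : FiniteMeasure X) {g : X → ℝ}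
    (hg : Measurable g) (hga : ∀ x, |g x| ≤ a) :
    ∫ x, g x ∂(μ : Measure X) - ∫ x, g x ∂(ν : Measure X) ≤ a * (tvNorm μ ν).toReal := by
  have hi : ∀ (ξ : Measure X) [IsFiniteMeasure ξ], Integrable g ξ := fun ξ _ =>
    Integrable.of_bound hg.aestronglyMeasurable a (.of_forall hga)
  have hb : ∀ (ξ : Measure X) [IsFiniteMeasure ξ], |∫ x, g x ∂ξ| ≤ a * (ξ univ).toReal :=
    fun ξ _ => by
    have := norm_integral_le_of_norm_le_const (μ := ξ) (f := g) (.of_forall hga)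
    rwa [Real.norm_eq_abs] at this
  have h := congrArg (fun ξ => ∫ x, g x ∂ξ) (add_sub_comm_measure μ ν)
  rw [integral_add_measure (hi _) (hi _), integral_add_measure (hi _) (hi _)] at h
  rw [tvNorm_eq_sub_add_sub, ENNReal.toReal_add (measure_ne_top _ _) (measure_ne_top _ _), mul_add]
  linarith [abs_le.1 (hb ((μ : Measure X) - ν)), abs_le.1 (hb ((ν : Measure X) - μ))]

end TotalVariation

/-! ### Weak duality -/

section WeakDuality

theorem genWasserstein_one_ne_top {X : Type*} [MetricSpace X] [MeasurableSpace X]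
    (a b : ℝ) (μ₁ μ₂ : FiniteMeasure X) :
    genWasserstein 1 a b μ₁ μ₂ ≠ ∞ := by
  have h : genWasserstein 1 a b μ₁ μ₂ ≤ ENNReal.ofReal a * tvNorm μ₁ 0 +
      ENNReal.ofReal a * tvNorm μ₂ 0 + ENNReal.ofReal b * wasserstein 1 (0 : FiniteMeasure X) 0 :=
    iInf_le_of_le 0 <| iInf_le_of_le 0 <| iInf_le_of_le (by simp [HasFiniteMoment]) <|
      iInf_le_of_le (by simp [HasFiniteMoment]) <| iInf_le_of_le rfl le_rfl
  refine ne_top_of_le_ne_top ?_ h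
  simp [wasserstein, ENNReal.mul_ne_top, tvNorm_ne_top]

theorem fst_smul_eq_of_mem_transferencePlans {X : Type*} [MeasurableSpace X]
    {μ ν : FiniteMeasure X} {π : ProbabilityMeasure (X × X)}
    (hπ : π ∈ transferencePlans μ ν) :
    (μ : Measure X) univ • (π : Measure (X × X)).fst = μ := by
  ext A hA
  rw [Measure.smul_apply, Measure.fst_apply hA, smul_eq_mul, ← hπ.1 A hA, prod_univ]

theorem snd_smul_eq_of_mem_transferencePlans {X : Type*} [MeasurableSpace X]
    {μ ν : FiniteMeasure X} {π : ProbabilityMeasure (X × X)}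
    (hπ : π ∈ transferencePlans μ ν) :
    (ν : Measure X) univ • (π : Measure (X × X)).snd = ν := by
  ext A hA
  rw [Measure.smul_apply, Measure.snd_apply hA, smul_eq_mul, ← hπ.2 A hA, univ_prod]

variable {X : Type*} [MetricSpace X] [TopologicalSpace.SeparableSpace X] [MeasurableSpace X]
  [BorelSpace X]

theorem ofReal_integral_add_le_wasserstein {b : ℝ} (hb : 0 < b) {μ ν : FiniteMeasure X}
    (h : (μ : Measure X) univ = (ν : Measure X) univ) {f g : X →ᵇ ℝ}
    (hfg : ∀ x y, f x + g y ≤ b * dist x y) :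
    ENNReal.ofReal (∫ x, f x ∂(μ : Measure X) + ∫ x, g x ∂(ν : Measure X)) ≤
      ENNReal.ofReal b * wasserstein 1 μ ν := by
  by_cases h0 : (μ : Measure X) univ = 0
  · have hμ : (μ : Measure X) = 0 := Measure.measure_univ_eq_zero.1 h0
    have hν : (ν : Measure X) = 0 := Measure.measure_univ_eq_zero.1 (h ▸ h0)
    rw [hμ, hν]
    simp
  have : SecondCountableTopology X := UniformSpace.secondCountable_of_separable X
  rw [wasserstein, div_one, ENNReal.rpow_one]
  simp only [ENNReal.mul_iInf_of_ne h0 (measure_ne_top _ _)]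
  simp only [ENNReal.mul_iInf_of_ne (ENNReal.ofReal_pos.2 hb).ne' ENNReal.ofReal_ne_top]
  refine le_iInf₂ fun π hπ => ?_
  have hf : ∫ x, f x ∂(μ : Measure X) =
      ((μ : Measure X) univ).toReal * ∫ z, f z.1 ∂(π : Measure (X × X)) := by
    conv_lhs => rw [← fst_smul_eq_of_mem_transferencePlans hπ]
    rw [integral_smul_measure, smul_eq_mul, Measure.fst, integral_map measurable_fst.aemeasurable
      f.continuous.aestronglyMeasurable]
  have hg : ∫ x, g x ∂(ν : Measure X) =
      ((μ : Measure X) univ).toReal * ∫ z, g z.2 ∂(π : Measure (X × X)) := by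
    conv_lhs => rw [← snd_smul_eq_of_mem_transferencePlans hπ]
    rw [integral_smul_measure, smul_eq_mul, Measure.snd, integral_map measurable_snd.aemeasurable
      g.continuous.aestronglyMeasurable, h]
  have hif : Integrable (fun z : X × X => f z.1) (π : Measure (X × X)) :=
    (f.compContinuous ⟨Prod.fst, continuous_fst⟩).integrable _
  have hig : Integrable (fun z : X × X => g z.2) (π : Measure (X × X)) :=
    (g.compContinuous ⟨Prod.snd, continuous_snd⟩).integrable _
  rw [hf, hg, ← mul_add, ← integral_add hif hig, ENNReal.ofReal_mul ENNReal.toReal_nonneg,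
    ENNReal.ofReal_toReal (measure_ne_top _ _), mul_left_comm]
  gcongr
  rw [transportCost, ← lintegral_const_mul' _ _ ENNReal.ofReal_ne_top]
  have hi := hif.add hig
  refine (ENNReal.ofReal_le_ofReal (integral_mono hi hi.pos_part fun z => le_max_left _ 0)).trans ?_
  rw [ofReal_integral_eq_lintegral_ofReal hi.pos_part (.of_forall fun z => le_max_right _ 0)]
  refine lintegral_mono fun z => ?_
  rw [ENNReal.rpow_one, edist_dist, ← ENNReal.ofReal_mul hb.le]
  exact ENNReal.ofReal_le_ofReal (max_le (hfg _ _) (by positivity))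

/-- The easy half of the duality: every admissible pair bounds the primal value from below. -/
theorem ofReal_dualValue_le_genWasserstein {a b : ℝ} (ha : 0 < a) (hb : 0 < b)
    (μ₁ μ₂ : FiniteMeasure X) {φ : (X →ᵇ ℝ) × (X →ᵇ ℝ)} (hφ : φ ∈ dualPairs X a b) :
    ENNReal.ofReal (dualValue a μ₁ μ₂ φ) ≤ genWasserstein 1 a b μ₁ μ₂ := by
  refine le_iInf fun μ' => le_iInf fun ν' => le_iInf fun _ => le_iInf fun _ => le_iInf fun h => ?_
  have key : ∀ (f : X →ᵇ ℝ), (∀ x, -a ≤ f x) → ∀ ξ ξ' : FiniteMeasure X,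
      ∫ x, (dualEntropy a (f x)).toReal ∂(ξ : Measure X) ≤
        a * (tvNorm ξ ξ').toReal + ∫ x, f x ∂(ξ' : Measure X) := by
    intro f hf ξ ξ'
    simp only [fun x => toReal_dualEntropy (hf x)]
    have hm : Measurable fun x => min (f x) a := f.continuous.measurable.min measurable_const
    have hbd : ∀ x, |min (f x) a| ≤ a := fun x =>
      abs_le.2 ⟨le_min (hf x) (by linarith), min_le_right _ _⟩
    have h₁ := integral_sub_integral_le_tvNorm ξ ξ' hm hbd
    have h₂ : ∫ x, min (f x) a ∂(ξ' : Measure X) ≤ ∫ x, f x ∂(ξ' : Measure X) :=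
      integral_mono (Integrable.of_bound hm.aestronglyMeasurable a (.of_forall hbd))
        (f.integrable _) fun x => min_le_left _ _
    linarith
  have h₁ := key φ.1 (fun x => (hφ x x).2.1) μ₁ μ'
  have h₂ := key φ.2 (fun x => (hφ x x).2.2) μ₂ ν'
  have hW := ofReal_integral_add_le_wasserstein hb h fun x y => (hφ x y).1
  calc ENNReal.ofReal (dualValue a μ₁ μ₂ φ)
      ≤ ENNReal.ofReal (a * (tvNorm μ₁ μ').toReal + a * (tvNorm μ₂ ν').toReal +
          (∫ x, φ.1 x ∂(μ' : Measure X) + ∫ x, φ.2 x ∂(ν' : Measure X))) :=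
        ENNReal.ofReal_le_ofReal (by unfold dualValue; linarith)
    _ ≤ ENNReal.ofReal (a * (tvNorm μ₁ μ').toReal) + ENNReal.ofReal (a * (tvNorm μ₂ ν').toReal) +
          ENNReal.ofReal (∫ x, φ.1 x ∂(μ' : Measure X) + ∫ x, φ.2 x ∂(ν' : Measure X)) :=
        ENNReal.ofReal_add_le.trans (add_le_add ENNReal.ofReal_add_le le_rfl)
    _ ≤ _ := by
        rw [ENNReal.ofReal_mul ha.le, ENNReal.ofReal_mul ha.le,
          ENNReal.ofReal_toReal (tvNorm_ne_top _ _), ENNReal.ofReal_toReal (tvNorm_ne_top _ _)]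
        gcongr

end WeakDuality

/-! ### Finite duality -/

section FiniteDuality

variable {ι κ : Type*} [Fintype ι] [Fintype κ]

/-- The cost of the plan `p` between finitely supported measures with weights `u.1`, `u.2`: shipping
one unit from `j` to `k` costs `c j k`, each unit by which a marginal of `p` misses its target
costs `a`. -/
def relaxedCost (a : ℝ) (c : ι → κ → ℝ) (u : (ι → ℝ) × (κ → ℝ)) (p : ι → κ → ℝ≥0) : ℝ :=
  a * ∑ j, |u.1 j - ∑ k, (p j k : ℝ)| + a * ∑ k, |u.2 k - ∑ j, (p j k : ℝ)|
    + ∑ j, ∑ k, c j k * p j k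

theorem relaxedCost_nonneg {a : ℝ} (ha : 0 ≤ a) {c : ι → κ → ℝ} (hc : ∀ j k, 0 ≤ c j k)
    (u : (ι → ℝ) × (κ → ℝ)) (p : ι → κ → ℝ≥0) : 0 ≤ relaxedCost a c u p := by
  have : ∀ j k, 0 ≤ c j k * (p j k : ℝ) := fun j k => mul_nonneg (hc j k) (p j k).2
  unfold relaxedCost
  have h : 0 ≤ ∑ j, ∑ k, c j k * (p j k : ℝ) :=
    Finset.sum_nonneg fun j _ => Finset.sum_nonneg fun k _ => this j k
  positivity

theorem relaxedCost_add_le {a : ℝ} (ha : 0 ≤ a) (c : ι → κ → ℝ)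
    (u v : (ι → ℝ) × (κ → ℝ)) (p q : ι → κ → ℝ≥0) :
    relaxedCost a c (u + v) (p + q) ≤ relaxedCost a c u p + relaxedCost a c v q := by
  have h₁ : ∑ j, |(u + v).1 j - ∑ k, ((p + q) j k : ℝ)| ≤
      ∑ j, |u.1 j - ∑ k, (p j k : ℝ)| + ∑ j, |v.1 j - ∑ k, (q j k : ℝ)| := by
    rw [← Finset.sum_add_distrib]
    refine Finset.sum_le_sum fun j _ => (le_of_eq ?_).trans (abs_add_le _ _)
    simp only [Prod.fst_add, Pi.add_apply, NNReal.coe_add, Finset.sum_add_distrib]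
    congr 1; ring
  have h₂ : ∑ k, |(u + v).2 k - ∑ j, ((p + q) j k : ℝ)| ≤
      ∑ k, |u.2 k - ∑ j, (p j k : ℝ)| + ∑ k, |v.2 k - ∑ j, (q j k : ℝ)| := by
    rw [← Finset.sum_add_distrib]
    refine Finset.sum_le_sum fun j _ => (le_of_eq ?_).trans (abs_add_le _ _)
    simp only [Prod.snd_add, Pi.add_apply, NNReal.coe_add, Finset.sum_add_distrib]
    congr 1; ring
  have h₃ : ∑ j, ∑ k, c j k * ((p + q) j k : ℝ) =
      ∑ j, ∑ k, c j k * (p j k : ℝ) + ∑ j, ∑ k, c j k * (q j k : ℝ) := by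
    simp only [Pi.add_apply, NNReal.coe_add, mul_add, Finset.sum_add_distrib]
  unfold relaxedCost
  rw [h₃]
  nlinarith [mul_le_mul_of_nonneg_left h₁ ha, mul_le_mul_of_nonneg_left h₂ ha]

theorem relaxedCost_smul (a : ℝ) (c : ι → κ → ℝ) (u : (ι → ℝ) × (κ → ℝ))
    (r : ℝ≥0) (p : ι → κ → ℝ≥0) :
    relaxedCost a c ((r : ℝ) • u) (r • p) = r * relaxedCost a c u p := by
  simp only [relaxedCost, Prod.smul_fst, Prod.smul_snd, Pi.smul_apply, smul_eq_mul, NNReal.coe_mul,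
    ← Finset.mul_sum, ← mul_sub, abs_mul, NNReal.abs_eq, mul_left_comm _ (r : ℝ)]
  ring

/-- Strong duality for the finite transport problem. The optimal value is a sublinear function of
the weights `u`, and the potentials are the coordinates of a linear functional below it which touches
it at `u`. -/
theorem exists_potentials {a : ℝ} (ha : 0 ≤ a) {c : ι → κ → ℝ} (hc : ∀ j k, 0 ≤ c j k)
    (m : ι → ℝ) (n : κ → ℝ) {K : ℝ} (hK : ∀ p, K ≤ relaxedCost a c (m, n) p) :
    ∃ (φ : ι → ℝ) (ψ : κ → ℝ), (∀ j, φ j ≤ a) ∧ (∀ k, |ψ k| ≤ a) ∧ (∀ j k, φ j + ψ k ≤ c j k) ∧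
      K ≤ ∑ j, φ j * m j + ∑ k, ψ k * n k := by
  classical
  set N : (ι → ℝ) × (κ → ℝ) → ℝ := fun u => ⨅ p, relaxedCost a c u p
  have hbdd : ∀ u, BddBelow (range (relaxedCost a c u)) := fun u =>
    ⟨0, by rintro _ ⟨p, rfl⟩; exact relaxedCost_nonneg ha hc u p⟩
  have hN_le : ∀ u p, N u ≤ relaxedCost a c u p := fun u p => ciInf_le (hbdd u) p
  have hN_nonneg : ∀ u, 0 ≤ N u := fun u => le_ciInf fun p => relaxedCost_nonneg ha hc u p
  have hN_smul_le : ∀ r : ℝ, 0 < r → ∀ u, r * N u ≤ N (r • u) := by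
    intro r hr u
    refine le_ciInf fun p => ?_
    have h := relaxedCost_smul a c (r • u) (r⁻¹).toNNReal p
    rw [Real.coe_toNNReal _ (inv_nonneg.2 hr.le), inv_smul_smul₀ hr.ne'] at h
    have h' := hN_le u ((r⁻¹).toNNReal • p)
    rw [h] at h'
    rwa [← le_inv_mul_iff₀ hr]
  have hN_smul : ∀ r : ℝ, 0 < r → ∀ u, N (r • u) = r * N u := by
    intro r hr u
    refine le_antisymm ?_ (hN_smul_le r hr u)
    have h := hN_smul_le r⁻¹ (inv_pos.2 hr) (r • u)
    rwa [inv_smul_smul₀ hr.ne', inv_mul_le_iff₀ hr] at h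
  have hN_add : ∀ u v, N (u + v) ≤ N u + N v := fun u v =>
    le_ciInf_add_ciInf fun p q => (hN_le _ _).trans (relaxedCost_add_le ha c u v p q)
  have hN_zero : N 0 = 0 := by
    refine le_antisymm ((hN_le 0 0).trans (le_of_eq ?_)) (hN_nonneg 0)
    simp [relaxedCost]
  obtain ⟨g, hg, hgN⟩ := exists_extension_of_le_sublinear
    (LinearPMap.mkSpanSingleton' (σ := RingHom.id ℝ) (m, n) (N (m, n)) (by
      intro r hr
      rcases smul_eq_zero.1 hr with h | h
      · simp [h]
      · simp [h, hN_zero])) N hN_smul hN_add (by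
      rintro ⟨x, hx⟩
      obtain ⟨r, rfl⟩ := Submodule.mem_span_singleton.1 hx
      rw [LinearPMap.mkSpanSingleton'_apply]
      rcases lt_or_ge 0 r with hr | hr
      · exact (hN_smul r hr _).ge
      · exact (mul_nonpos_of_nonpos_of_nonneg hr (hN_nonneg _)).trans (hN_nonneg _))
  have hg' : g (m, n) = N (m, n) :=
    (hg ⟨(m, n), Submodule.mem_span_singleton_self _⟩).trans
      (LinearPMap.mkSpanSingleton'_apply_self _ _ _ _)
  have hsum : g (m, n) = ∑ j, g (Pi.single j 1, 0) * m j + ∑ k, g (0, Pi.single k 1) * n k := by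
    have h : (m, n) = ∑ j, m j • ((Pi.single j 1, 0) : (ι → ℝ) × (κ → ℝ)) +
        ∑ k, n k • ((0, Pi.single k 1) : (ι → ℝ) × (κ → ℝ)) := by
      ext i
      · simp [Prod.fst_sum, Finset.sum_apply, Pi.single_apply]
      · simp [Prod.snd_sum, Finset.sum_apply, Pi.single_apply]
    conv_lhs => rw [h]
    simp only [map_add, map_sum, map_smul, smul_eq_mul, mul_comm]
  have habs : ∀ k l : κ, |(Pi.single k (1 : ℝ) : κ → ℝ) l| = (Pi.single k (1 : ℝ) : κ → ℝ) l := by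
    intro k l
    by_cases h : l = k <;> simp [h]
  have habs' : ∀ k l : ι, |(Pi.single k (1 : ℝ) : ι → ℝ) l| = (Pi.single k (1 : ℝ) : ι → ℝ) l := by
    intro k l
    by_cases h : l = k <;> simp [h]
  -- testing `g ≤ N` on unit vectors with the zero plan, or with the plan shipping one unit from `j` to
  -- `k`, gives the constraints
  refine ⟨fun j => g (Pi.single j 1, 0), fun k => g (0, Pi.single k 1), fun j => ?_, fun k => ?_,
    fun j k => ?_, ?_⟩
  · refine ((hgN _).trans (hN_le _ 0)).trans (le_of_eq ?_)
    simp [relaxedCost, habs']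
  · refine abs_le'.2 ⟨((hgN _).trans (hN_le _ 0)).trans (le_of_eq ?_), ?_⟩
    · simp [relaxedCost, habs]
    · rw [← map_neg]
      refine ((hgN _).trans (hN_le _ 0)).trans (le_of_eq ?_)
      simp [relaxedCost, habs]
  · rw [← map_add]
    refine ((hgN _).trans (hN_le _ (Pi.single j (Pi.single k 1)))).trans (le_of_eq ?_)
    have h₁ : ∀ i, ∑ l, ((Pi.single j (Pi.single k 1) : ι → κ → ℝ≥0) i l : ℝ) =
        (Pi.single j (1 : ℝ) : ι → ℝ) i := by
      intro i
      by_cases h : i = j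
      · subst h; simp [Pi.single_apply, apply_ite]
      · simp [h]
    have h₂ : ∀ l, ∑ i, ((Pi.single j (Pi.single k 1) : ι → κ → ℝ≥0) i l : ℝ) =
        (Pi.single k (1 : ℝ) : κ → ℝ) l := by
      intro l
      rw [Finset.sum_eq_single j (fun i _ h => by simp [h]) (by simp)]
      by_cases h : l = k
      · subst h; simp
      · simp [h]
    have h₃ : ∑ i, ∑ l, c i l * ((Pi.single j (Pi.single k 1) : ι → κ → ℝ≥0) i l : ℝ) = c j k := by
      rw [Finset.sum_eq_single j (fun i _ h => by simp [h]) (by simp),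
        Finset.sum_eq_single k (fun l _ h => by simp [h]) (by simp)]
      simp
    simp [relaxedCost, h₁, h₂, h₃]
  · rw [← hsum, hg']
    exact le_ciInf hK

end FiniteDuality

/-! ### Lifting finite plans to transference plans -/

section Lifting

variable {X : Type*} [MetricSpace X] [MeasurableSpace X]

/-- The normalized restriction of `μ` to `A`; when `A` is `μ`-null the Dirac mass at `x` serves. -/
theorem exists_probabilityMeasure_smul_eq_restrict (μ : Measure X) [IsFiniteMeasure μ] {A : Set X}
    {x : X} {δ : ℝ} (hδ : 0 < δ) (hA : A ⊆ Metric.ball x δ) [OpensMeasurableSpace X] :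
    ∃ ρ : ProbabilityMeasure X, μ A • (ρ : Measure X) = μ.restrict A ∧
      ∀ᵐ y ∂(ρ : Measure X), y ∈ Metric.ball x δ := by
  by_cases h : μ A = 0
  · refine ⟨⟨Measure.dirac x, inferInstance⟩, ?_, ?_⟩
    · rw [h, zero_smul, Measure.restrict_eq_zero.2 h]
    · exact (ae_dirac_iff Metric.isOpen_ball.measurableSet).2 (Metric.mem_ball_self hδ)
  · refine ⟨⟨(μ A)⁻¹ • μ.restrict A, ⟨?_⟩⟩, ?_, ?_⟩
    · simp [ENNReal.inv_mul_cancel h (measure_ne_top _ _)]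
    · simp [smul_smul, ENNReal.mul_inv_cancel h (measure_ne_top _ _)]
    · refine Measure.ae_smul_measure ?_ _
      exact ae_restrict_of_ae_restrict_of_subset hA
        (ae_restrict_mem Metric.isOpen_ball.measurableSet)

variable {ι : Type*} [Fintype ι]

/-- The conditional laws `ρ j` of `μ` on the cells are reweighted from `μ (A j)` to `r j`; only the mass
outside the cells and the changes of weight contribute to the total variation. -/
theorem tvNorm_le_of_eq_sum {X : Type*} [MeasurableSpace X] {μ μ' : FiniteMeasure X} {A : ι → Set X}
    (hA : ∀ j, MeasurableSet (A j)) (hd : Pairwise (Function.onFun Disjoint A))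
    {ρ : ι → ProbabilityMeasure X}
    (hρ : ∀ j, (μ : Measure X) (A j) • (ρ j : Measure X) = (μ : Measure X).restrict (A j))
    {r : ι → ℝ≥0} (hμ' : (μ' : Measure X) = ∑ j, (r j : ℝ≥0∞) • (ρ j : Measure X)) :
    tvNorm μ μ' ≤ (μ : Measure X) (⋃ j, A j)ᶜ +
      ∑ j, ENNReal.ofReal |(μ : Measure X).real (A j) - r j| := by
  have hμ : (μ : Measure X) = (μ : Measure X).restrict (⋃ j, A j)ᶜ +
      ∑ j, (μ : Measure X) (A j) • (ρ j : Measure X) := by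
    simp only [hρ]
    rw [← Measure.sum_fintype, ← Measure.restrict_iUnion hd hA,
      Measure.restrict_compl_add_restrict (MeasurableSet.iUnion hA)]
  have h : tvNorm μ μ' ≤ ((μ : Measure X).restrict (⋃ j, A j)ᶜ +
      ∑ j, ENNReal.ofReal |(μ : Measure X).real (A j) - r j| • (ρ j : Measure X)) univ := by
    apply tvNorm_le_of_le_add
    · conv_lhs => rw [hμ]
      rw [hμ', add_assoc, ← Finset.sum_add_distrib]
      refine add_le_add le_rfl (Finset.sum_le_sum fun j _ => ?_)
      rw [← add_smul]
      gcongr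
      rw [← ENNReal.ofReal_coe_nnreal, ← ENNReal.ofReal_add (abs_nonneg _) (r j).coe_nonneg,
        ← ofReal_measureReal]
      exact ENNReal.ofReal_le_ofReal (by linarith [le_abs_self ((μ : Measure X).real (A j) - r j)])
    · refine le_of_le_of_eq ?_ (congrArg (_ + ·) hμ.symm)
      rw [hμ', add_add_add_comm, ← Finset.sum_add_distrib]
      refine (Finset.sum_le_sum fun j _ => ?_).trans
        (Measure.le_add_left le_rfl)
      rw [← add_smul]
      gcongr
      rw [← ENNReal.ofReal_coe_nnreal, ← ofReal_measureReal,
        ← ENNReal.ofReal_add (abs_nonneg _) measureReal_nonneg]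
      exact ENNReal.ofReal_le_ofReal
        (by linarith [neg_abs_le ((μ : Measure X).real (A j) - r j)])
  simpa using h

theorem hasFiniteMoment_of_eq_sum [OpensMeasurableSpace X] {μ : FiniteMeasure X}
    {ρ : ι → ProbabilityMeasure X} {x : ι → X} {δ : ℝ}
    (hρ : ∀ j, ∀ᵐ y ∂(ρ j : Measure X), y ∈ Metric.ball (x j) δ)
    {r : ι → ℝ≥0} (hμ : (μ : Measure X) = ∑ j, (r j : ℝ≥0∞) • (ρ j : Measure X)) :
    HasFiniteMoment 1 μ := by
  intro x₀
  rw [hμ, lintegral_finsetSum_measure]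
  refine ENNReal.sum_lt_top.2 fun j _ => ?_
  rw [lintegral_smul_measure, smul_eq_mul]
  refine ENNReal.mul_lt_top ENNReal.coe_lt_top ?_
  refine (lintegral_mono_ae (g := fun _ => ENNReal.ofReal (δ + dist (x j) x₀)) ?_).trans_lt ?_
  · filter_upwards [hρ j] with y hy
    rw [ENNReal.rpow_one, edist_dist]
    refine ENNReal.ofReal_le_ofReal ?_
    linarith [dist_triangle y (x j) x₀, Metric.mem_ball.1 hy]
  · simp

/-- The transference plan behind the bound is the mixture of the products `ρ j ⊗ σ k` with weights
`p j k`, normalized by the total weight. -/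
theorem wasserstein_le_of_eq_sum [OpensMeasurableSpace X] {μ ν : FiniteMeasure X}
    {ρ σ : ι → ProbabilityMeasure X} {x : ι → X} {δ : ℝ}
    (hρ : ∀ j, ∀ᵐ y ∂(ρ j : Measure X), y ∈ Metric.ball (x j) δ)
    (hσ : ∀ j, ∀ᵐ y ∂(σ j : Measure X), y ∈ Metric.ball (x j) δ)
    {p : ι → ι → ℝ≥0}
    (hμ : (μ : Measure X) = ∑ j, ∑ k, (p j k : ℝ≥0∞) • (ρ j : Measure X))
    (hν : (ν : Measure X) = ∑ j, ∑ k, (p j k : ℝ≥0∞) • (σ k : Measure X)) :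
    wasserstein 1 μ ν ≤ ∑ j, ∑ k, p j k * ENNReal.ofReal (dist (x j) (x k) + 2 * δ) := by
  set M : ℝ≥0∞ := ∑ j, ∑ k, (p j k : ℝ≥0∞) with hM
  have hμM : (μ : Measure X) univ = M := by simp [hμ, hM]
  have hνM : (ν : Measure X) univ = M := by simp [hν, hM]
  rw [wasserstein, hμM, div_one, ENNReal.rpow_one]
  by_cases h0 : M = 0
  · simp [h0]
  have hM_top : M ≠ ∞ := hμM ▸ measure_ne_top _ _
  set γ : Measure (X × X) :=
    ∑ j, ∑ k, (p j k : ℝ≥0∞) • ((ρ j : Measure X).prod (σ k : Measure X)) with hγ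
  have hγM : γ univ = M := by simp [hγ, hM]
  have hπ : IsProbabilityMeasure (M⁻¹ • γ) :=
    ⟨by rw [Measure.smul_apply, hγM, smul_eq_mul, ENNReal.inv_mul_cancel h0 hM_top]⟩
  have hmem : (⟨M⁻¹ • γ, hπ⟩ : ProbabilityMeasure (X × X)) ∈ transferencePlans μ ν := by
    constructor
    · intro A hA
      rw [hμM, ProbabilityMeasure.coe_mk, Measure.smul_apply, smul_eq_mul, ← mul_assoc,
        ENNReal.mul_inv_cancel h0 hM_top, one_mul]
      simp [hγ, hμ, Measure.prod_prod]
    · intro B hB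
      rw [hνM, ProbabilityMeasure.coe_mk, Measure.smul_apply, smul_eq_mul, ← mul_assoc,
        ENNReal.mul_inv_cancel h0 hM_top, one_mul]
      simp [hγ, hν, Measure.prod_prod]
  calc M * ⨅ π ∈ transferencePlans μ ν, transportCost 1 π
      ≤ M * transportCost 1 ⟨M⁻¹ • γ, hπ⟩ := by gcongr; exact iInf₂_le _ hmem
    _ = ∑ j, ∑ k, p j k * ∫⁻ z, edist z.1 z.2 ^ (1 : ℝ)
          ∂((ρ j : Measure X).prod (σ k : Measure X)) := by
        unfold transportCost
        rw [ProbabilityMeasure.coe_mk, lintegral_smul_measure, smul_eq_mul,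
          ← mul_assoc, ENNReal.mul_inv_cancel h0 hM_top, one_mul, hγ]
        simp only [lintegral_finsetSum_measure, lintegral_smul_measure, smul_eq_mul]
    _ ≤ _ := by
        gcongr with j _ k _
        refine (lintegral_mono_ae
          (g := fun _ => ENNReal.ofReal (dist (x j) (x k) + 2 * δ)) ?_).trans (by simp)
        filter_upwards [Measure.quasiMeasurePreserving_fst.ae (hρ j),
          Measure.quasiMeasurePreserving_snd.ae (hσ k)] with z h₁ h₂
        rw [ENNReal.rpow_one, edist_dist]
        refine ENNReal.ofReal_le_ofReal ?_
        rw [Metric.mem_ball] at h₁ h₂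
        linarith [dist_triangle4 z.1 (x j) (x k) z.2, dist_comm (x k) z.2]

/-- A plan between the quantized weights of `μ₁` and `μ₂` spreads over the cells `A j` to a
competitor in the primal problem; `2 δ` pays for the distance of the points of a cell to its
center. -/
theorem genWasserstein_le_relaxedCost [OpensMeasurableSpace X] {a b : ℝ} (ha : 0 ≤ a) (hb : 0 ≤ b)
    (μ₁ μ₂ : FiniteMeasure X) {A : ι → Set X} (hA : ∀ j, MeasurableSet (A j))
    (hd : Pairwise (Function.onFun Disjoint A)) {x : ι → X} {δ : ℝ} (hδ : 0 < δ)
    (hAx : ∀ j, A j ⊆ Metric.ball (x j) δ) (p : ι → ι → ℝ≥0) :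
    (genWasserstein 1 a b μ₁ μ₂).toReal ≤
      a * (μ₁ : Measure X).real (⋃ j, A j)ᶜ + a * (μ₂ : Measure X).real (⋃ j, A j)ᶜ +
      relaxedCost a (fun j k => b * (dist (x j) (x k) + 2 * δ))
        (fun j => (μ₁ : Measure X).real (A j), fun k => (μ₂ : Measure X).real (A k)) p := by
  choose ρ hρ hρx using fun j =>
    exists_probabilityMeasure_smul_eq_restrict (μ₁ : Measure X) hδ (hAx j)
  choose σ hσ hσx using fun j =>
    exists_probabilityMeasure_smul_eq_restrict (μ₂ : Measure X) hδ (hAx j)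
  have hfin : ∀ τ : ι → ι → ProbabilityMeasure X,
      IsFiniteMeasure (∑ j, ∑ k, (p j k : ℝ≥0∞) • (τ j k : Measure X)) := fun τ =>
    ⟨by simp [ENNReal.sum_lt_top]⟩
  let μ' : FiniteMeasure X := ⟨_, hfin fun j _ => ρ j⟩
  let ν' : FiniteMeasure X := ⟨_, hfin fun _ k => σ k⟩
  have hμ' : (μ' : Measure X) = ∑ j, ((∑ k, p j k : ℝ≥0) : ℝ≥0∞) • (ρ j : Measure X) := by
    simp [μ', Finset.sum_smul]
  have hν' : (ν' : Measure X) = ∑ k, ((∑ j, p j k : ℝ≥0) : ℝ≥0∞) • (σ k : Measure X) := by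
    simp only [ν', FiniteMeasure.toMeasure_mk, ENNReal.ofNNReal_finsetSum, Finset.sum_smul]
    exact Finset.sum_comm
  have hmass : (μ' : Measure X) univ = (ν' : Measure X) univ := by simp [μ', ν']
  have h := (iInf_le_of_le μ' <| iInf_le_of_le ν' <|
    iInf_le_of_le (hasFiniteMoment_of_eq_sum hρx hμ') <|
    iInf_le_of_le (hasFiniteMoment_of_eq_sum hσx hν') <| iInf_le_of_le hmass le_rfl :
    genWasserstein 1 a b μ₁ μ₂ ≤ ENNReal.ofReal a * tvNorm μ₁ μ' + ENNReal.ofReal a * tvNorm μ₂ ν'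
      + ENNReal.ofReal b * wasserstein 1 μ' ν')
  have hc : ∀ j k, 0 ≤ dist (x j) (x k) + 2 * δ := fun j k => by positivity
  have hterm : ∀ j k, 0 ≤ b * (dist (x j) (x k) + 2 * δ) * (p j k : ℝ) := fun j k =>
    mul_nonneg (mul_nonneg hb (hc j k)) (p j k).coe_nonneg
  refine ENNReal.toReal_le_of_le_ofReal
    (add_nonneg (by positivity) (relaxedCost_nonneg ha (fun j k => mul_nonneg hb (hc j k)) _ _))
    (h.trans ?_)
  refine (add_le_add (add_le_add (mul_le_mul_right (tvNorm_le_of_eq_sum hA hd hρ hμ') _)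
    (mul_le_mul_right (tvNorm_le_of_eq_sum hA hd hσ hν') _))
    (mul_le_mul_right (wasserstein_le_of_eq_sum hρx hσx rfl rfl) _)).trans (le_of_eq ?_)
  have hsum : ∀ (μ : FiniteMeasure X) (r : ι → ℝ≥0), ENNReal.ofReal a *
      ((μ : Measure X) (⋃ j, A j)ᶜ + ∑ j, ENNReal.ofReal |(μ : Measure X).real (A j) - r j|) =
      ENNReal.ofReal (a * ((μ : Measure X).real (⋃ j, A j)ᶜ +
        ∑ j, |(μ : Measure X).real (A j) - r j|)) := by
    intro μ r
    rw [ENNReal.ofReal_mul ha, ENNReal.ofReal_add measureReal_nonneg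
      (Finset.sum_nonneg fun _ _ => abs_nonneg _),
      ENNReal.ofReal_sum_of_nonneg fun _ _ => abs_nonneg _, ofReal_measureReal]
  have hcost : ENNReal.ofReal b * ∑ j, ∑ k, p j k * ENNReal.ofReal (dist (x j) (x k) + 2 * δ) =
      ENNReal.ofReal (∑ j, ∑ k, b * (dist (x j) (x k) + 2 * δ) * p j k) := by
    rw [ENNReal.ofReal_sum_of_nonneg fun j _ => Finset.sum_nonneg fun k _ => hterm j k,
      Finset.mul_sum]
    refine Finset.sum_congr rfl fun j _ => ?_
    rw [ENNReal.ofReal_sum_of_nonneg fun k _ => hterm j k, Finset.mul_sum]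
    refine Finset.sum_congr rfl fun k _ => ?_
    rw [ENNReal.ofReal_mul (mul_nonneg hb (hc j k)), ENNReal.ofReal_mul hb,
      ENNReal.ofReal_coe_nnreal]
    ring
  have hcost_nonneg : 0 ≤ ∑ j, ∑ k, b * (dist (x j) (x k) + 2 * δ) * (p j k : ℝ) :=
    Finset.sum_nonneg fun j _ => Finset.sum_nonneg fun k _ => hterm j k
  have hnonneg : ∀ (μ : FiniteMeasure X) (r : ι → ℝ≥0), 0 ≤ a * ((μ : Measure X).real (⋃ j, A j)ᶜ +
      ∑ j, |(μ : Measure X).real (A j) - r j|) := fun μ r =>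
    mul_nonneg ha (add_nonneg measureReal_nonneg (Finset.sum_nonneg fun _ _ => abs_nonneg _))
  rw [hsum, hsum, hcost, ← ENNReal.ofReal_add (hnonneg _ _) (hnonneg _ _),
    ← ENNReal.ofReal_add (add_nonneg (hnonneg _ _) (hnonneg _ _)) hcost_nonneg]
  simp only [relaxedCost, NNReal.coe_sum]
  congr 1
  ring

end Lifting

/-! ### Extending finite potentials -/

section Extension

variable {X : Type*} [MetricSpace X]

/-- A single Lipschitz function `F` replaces both potentials: `F` is the `c`-transform of `ψ`, cut
off at `a`, so that `F` dominates `φ` and `-F` dominates `ψ - η`. -/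
theorem exists_lipschitz_extension {ι : Type*} [Finite ι] {a b η : ℝ} (ha : 0 ≤ a) (hb : 0 ≤ b)
    (hη : 0 ≤ η) (x : ι → X) {φ ψ : ι → ℝ} (hφ : ∀ j, φ j ≤ a) (hψ : ∀ k, |ψ k| ≤ a)
    (h : ∀ j k, φ j + ψ k ≤ b * dist (x j) (x k) + η) :
    ∃ F : X →ᵇ ℝ, (∀ y, |F y| ≤ a) ∧ (∀ y z, F y - F z ≤ b * dist y z) ∧
      ∀ j, φ j ≤ F (x j) ∧ F (x j) ≤ η - ψ j := by
  -- the value at `none` performs the cut-off and keeps the infimum meaningful for empty `ι`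
  let G : X → Option ι → ℝ := fun y o => o.elim a fun k => b * dist y (x k) + η - ψ k
  let F : X → ℝ := fun y => ⨅ o, G y o
  have hbdd : ∀ y, BddBelow (range (G y)) := fun y => (finite_range _).bddBelow
  have hF_le : ∀ y o, F y ≤ G y o := fun y o => ciInf_le (hbdd y) o
  have hF_abs : ∀ y, |F y| ≤ a := by
    refine fun y => abs_le.2 ⟨le_ciInf fun o => ?_, hF_le y none⟩
    cases o with
    | none => simpa [G] using by linarith
    | some k =>
      have := mul_nonneg hb (dist_nonneg (x := y) (y := x k))
      have := (abs_le.1 (hψ k)).2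
      simp only [G, Option.elim]
      linarith
  have hF_lip : ∀ y z, F y - F z ≤ b * dist y z := by
    intro y z
    rw [sub_le_iff_le_add, ← sub_le_iff_le_add']
    refine le_ciInf fun o => ?_
    rw [sub_le_iff_le_add']
    refine (hF_le y o).trans ?_
    cases o with
    | none => simpa [G] using mul_nonneg hb dist_nonneg
    | some k =>
      have := mul_le_mul_of_nonneg_left (dist_triangle y z (x k)) hb
      simp only [G, Option.elim]
      linarith
  have hF_cont : Continuous F := by
    refine (LipschitzWith.of_dist_le_mul (K := b.toNNReal) fun y z => ?_).continuous
    rw [Real.coe_toNNReal _ hb, Real.dist_eq]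
    exact abs_sub_le_iff.2 ⟨hF_lip y z, dist_comm y z ▸ hF_lip z y⟩
  refine ⟨BoundedContinuousFunction.ofNormedAddCommGroup F hF_cont a hF_abs, hF_abs, hF_lip,
    fun j => ⟨le_ciInf fun o => ?_, (hF_le _ (some j)).trans (by simp [G])⟩⟩
  cases o with
  | none => exact hφ j
  | some k =>
    simp only [G, Option.elim]
    linarith [h j k]

end Extension

/-! ### Quantization -/

section Quantization

variable {X : Type*} [MetricSpace X] [MeasurableSpace X]

/-- Tightness of finite measures on a Polish space: up to mass `δ`, both measures live on finitely many
disjoint cells of radius `δ`. -/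
theorem exists_disjoint_cells [CompleteSpace X] [TopologicalSpace.SeparableSpace X] [BorelSpace X]
    (μ₁ μ₂ : FiniteMeasure X) {δ : ℝ} (hδ : 0 < δ) :
    ∃ (n : ℕ) (x : Fin n → X) (A : Fin n → Set X), (∀ j, MeasurableSet (A j)) ∧
      Pairwise (Function.onFun Disjoint A) ∧ (∀ j, A j ⊆ Metric.ball (x j) δ) ∧
      (μ₁ : Measure X).real (⋃ j, A j)ᶜ ≤ δ ∧ (μ₂ : Measure X).real (⋃ j, A j)ᶜ ≤ δ := by
  have : SecondCountableTopology X := UniformSpace.secondCountable_of_separable X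
  obtain ⟨K, -, hK, hKμ⟩ := MeasurableSet.univ.exists_isCompact_sdiff_lt
    (μ := (μ₁ : Measure X) + (μ₂ : Measure X)) (measure_ne_top _ _) (ENNReal.ofReal_pos.2 hδ).ne'
  obtain ⟨t, -, ht, hKt⟩ := hK.finite_cover_balls hδ
  obtain ⟨n, x, -, rfl⟩ := ht.fin_param
  have hsub : (⋃ j, disjointed (fun j => Metric.ball (x j) δ) j)ᶜ ⊆ univ \ K := by
    rw [iUnion_disjointed, compl_eq_univ_sdiff]
    exact sdiff_subset_sdiff_right (by simpa using hKt)
  have hle : ∀ μ : FiniteMeasure X, (μ : Measure X) ≤ (μ₁ : Measure X) + (μ₂ : Measure X) →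
      (μ : Measure X).real (⋃ j, disjointed (fun j => Metric.ball (x j) δ) j)ᶜ ≤ δ := fun μ h =>
    ENNReal.toReal_le_of_le_ofReal hδ.le (((h _).trans (measure_mono hsub)).trans hKμ.le)
  refine ⟨n, x, disjointed fun j => Metric.ball (x j) δ, fun j => ?_, disjoint_disjointed _,
    fun j => disjointed_subset _ j, hle μ₁ (Measure.le_add_right le_rfl),
    hle μ₂ (Measure.le_add_left le_rfl)⟩
  exact disjointedRec (p := MeasurableSet) (fun _ _ h => h.diff Metric.isOpen_ball.measurableSet)
    Metric.isOpen_ball.measurableSet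

/-- The Riemann sum of `f` over the cells exceeds the integral by at most the oscillation `ω` of `f`
on the cells plus what the part of `μ` outside the cells can contribute. -/
theorem sum_mul_le_integral {ι : Type*} [Fintype ι] [OpensMeasurableSpace X] {a ω : ℝ}
    (hω : 0 ≤ ω) (μ : FiniteMeasure X) {A : ι → Set X}
    (hA : ∀ j, MeasurableSet (A j)) (hd : Pairwise (Function.onFun Disjoint A)) {x : ι → X}
    {f : X →ᵇ ℝ} (hfa : ∀ y, |f y| ≤ a) (hf : ∀ j, ∀ y ∈ A j, f (x j) ≤ f y + ω) :
    ∑ j, f (x j) * (μ : Measure X).real (A j) ≤ ∫ y, f y ∂(μ : Measure X) +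
      ω * (μ : Measure X).real univ + a * (μ : Measure X).real (⋃ j, A j)ᶜ := by
  have hi := f.integrable (μ : Measure X)
  have h₀ : -(a * (μ : Measure X).real (⋃ j, A j)ᶜ) ≤ ∫ y in (⋃ j, A j)ᶜ, f y ∂(μ : Measure X) :=
    (abs_le.1 ((Real.norm_eq_abs _).symm.le.trans (norm_setIntegral_le_of_norm_le_const
      (f := f) (measure_lt_top _ _) fun y _ => hfa y))).1
  have h₁ : ∀ j, (f (x j) - ω) * (μ : Measure X).real (A j) ≤ ∫ y in A j, f y ∂(μ : Measure X) := by
    intro j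
    have := setIntegral_mono_on (integrable_const (f (x j) - ω)).integrableOn hi.integrableOn (hA j)
      (fun y hy => by linarith [hf j y hy])
    rwa [setIntegral_const, smul_eq_mul, mul_comm] at this
  have h₂ : ∑ j, (μ : Measure X).real (A j) ≤ (μ : Measure X).real univ := by
    rw [← measureReal_iUnion_fintype hd hA]
    exact measureReal_mono (subset_univ _)
  have h₃ : ∫ y, f y ∂(μ : Measure X) = ∑ j, ∫ y in A j, f y ∂(μ : Measure X) +
      ∫ y in (⋃ j, A j)ᶜ, f y ∂(μ : Measure X) := by
    rw [← integral_add_compl (MeasurableSet.iUnion hA) hi,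
      integral_iUnion_fintype hA hd fun _ => hi.integrableOn]
  have h₄ := Finset.sum_le_sum fun j (_ : j ∈ Finset.univ) => h₁ j
  simp only [sub_mul, Finset.sum_sub_distrib, ← Finset.mul_sum] at h₄
  nlinarith [mul_le_mul_of_nonneg_left h₂ hω]

end Quantization

/-! ### Strong duality -/

section StrongDuality

/-- Lipschitz functions with values in `[-a, a]` give admissible pairs, on which `I` acts as the
identity. -/
theorem mem_dualPairs_neg {X : Type*} [MetricSpace X] {a b : ℝ} {F : X →ᵇ ℝ} (hFa : ∀ y, |F y| ≤ a)
    (hF : ∀ y z, F y - F z ≤ b * dist y z) : (F, -F) ∈ dualPairs X a b := fun y z =>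
  ⟨by simpa [sub_eq_add_neg] using hF y z, (abs_le.1 (hFa y)).1,
    by simpa using (abs_le.1 (hFa z)).2⟩

theorem dualValue_neg {X : Type*} [MetricSpace X] [MeasurableSpace X] {a : ℝ} {F : X →ᵇ ℝ}
    (hFa : ∀ y, |F y| ≤ a) (μ₁ μ₂ : FiniteMeasure X) :
    dualValue a μ₁ μ₂ (F, -F) =
      ∫ y, F y ∂(μ₁ : Measure X) + ∫ y, (-F) y ∂(μ₂ : Measure X) := by
  have h₁ : ∀ y, (dualEntropy a (F y)).toReal = F y := fun y => by
    rw [toReal_dualEntropy (abs_le.1 (hFa y)).1, min_eq_left (abs_le.1 (hFa y)).2]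
  have h₂ : ∀ y, (dualEntropy a ((-F) y)).toReal = (-F) y := fun y => by
    have h : |(-F) y| ≤ a := by simpa using hFa y
    rw [toReal_dualEntropy (abs_le.1 h).1, min_eq_left (abs_le.1 h).2]
  simp only [dualValue, h₁, h₂]

variable {X : Type*} [MetricSpace X] [CompleteSpace X] [TopologicalSpace.SeparableSpace X]
  [MeasurableSpace X] [BorelSpace X]

/-- The duality gap at scale `δ` is `O(δ)`: potentials of the quantized problem extend to an
admissible pair `(F, -F)` on `X`. -/
theorem exists_dualPair_genWasserstein_le {a b : ℝ} (ha : 0 < a) (hb : 0 < b)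
    (μ₁ μ₂ : FiniteMeasure X) {δ : ℝ} (hδ : 0 < δ) :
    ∃ φ ∈ dualPairs X a b, (genWasserstein 1 a b μ₁ μ₂).toReal ≤ dualValue a μ₁ μ₂ φ +
      (b * ((μ₁ : Measure X).real univ + 3 * (μ₂ : Measure X).real univ) + 4 * a) * δ := by
  obtain ⟨n, x, A, hA, hd, hAx, h₁, h₂⟩ := exists_disjoint_cells μ₁ μ₂ hδ
  have hc : ∀ j k, 0 ≤ b * (dist (x j) (x k) + 2 * δ) := fun j k => by positivity
  obtain ⟨φ, ψ, hφ, hψ, hφψ, hK⟩ := exists_potentials ha.le hc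
    (fun j => (μ₁ : Measure X).real (A j)) (fun k => (μ₂ : Measure X).real (A k))
    (fun p => sub_le_iff_le_add'.2
      (genWasserstein_le_relaxedCost ha.le hb.le μ₁ μ₂ hA hd hδ hAx p))
  obtain ⟨F, hFa, hF, hFx⟩ := exists_lipschitz_extension ha.le hb.le
    (mul_nonneg hb.le (mul_nonneg zero_le_two hδ.le)) x hφ hψ
    (fun j k => (hφψ j k).trans_eq (mul_add _ _ _))
  refine ⟨(F, -F), mem_dualPairs_neg hFa hF, ?_⟩
  rw [dualValue_neg hFa]
  have hω : 0 ≤ b * δ := by positivity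
  have hdist : ∀ j, ∀ y ∈ A j, dist y (x j) ≤ δ := fun j y hy => (Metric.mem_ball.1 (hAx j hy)).le
  have i₁ := sum_mul_le_integral hω μ₁ hA hd (f := F) hFa fun j y hy => by
    have := mul_le_mul_of_nonneg_left (hdist j y hy) hb.le
    linarith [hF (x j) y, dist_comm y (x j) ▸ this]
  have i₂ := sum_mul_le_integral hω μ₂ hA hd (f := -F) (by simpa using hFa) fun j y hy => by
    have := mul_le_mul_of_nonneg_left (hdist j y hy) hb.le
    simp only [BoundedContinuousFunction.coe_neg, Pi.neg_apply]
    linarith [hF y (x j)]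
  have s₁ : ∑ j, φ j * (μ₁ : Measure X).real (A j) ≤ ∑ j, F (x j) * (μ₁ : Measure X).real (A j) :=
    Finset.sum_le_sum fun j _ => mul_le_mul_of_nonneg_right (hFx j).1 measureReal_nonneg
  have s₂ : ∑ j, ψ j * (μ₂ : Measure X).real (A j) ≤
      ∑ j, (-F) (x j) * (μ₂ : Measure X).real (A j) +
        b * (2 * δ) * (μ₂ : Measure X).real univ := by
    have hm : ∑ j, (μ₂ : Measure X).real (A j) ≤ (μ₂ : Measure X).real univ := by
      rw [← measureReal_iUnion_fintype hd hA]
      exact measureReal_mono (subset_univ _)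
    refine le_trans ?_ (add_le_add le_rfl (mul_le_mul_of_nonneg_left hm (by positivity)))
    rw [Finset.mul_sum, ← Finset.sum_add_distrib]
    refine Finset.sum_le_sum fun j _ => ?_
    rw [← add_mul]
    refine mul_le_mul_of_nonneg_right ?_ measureReal_nonneg
    simp only [BoundedContinuousFunction.coe_neg, Pi.neg_apply]
    linarith [(hFx j).2]
  linarith [mul_le_mul_of_nonneg_left h₁ ha.le, mul_le_mul_of_nonneg_left h₂ ha.le]

end StrongDuality

theorem exists_dualEntropy_eq_coe {a t : ℝ} (ht : -a ≤ t) : ∃ r : ℝ, dualEntropy a t = (r : EReal) :=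
  ⟨_, dualEntropy_of_neg_le ht⟩

theorem integrable_dualEntropy {X : Type*} [MetricSpace X] [MeasurableSpace X]
    [OpensMeasurableSpace X] {a : ℝ} {f : X →ᵇ ℝ} (hf : ∀ x, -a ≤ f x) (μ : FiniteMeasure X) :
    Integrable (fun x => (dualEntropy a (f x)).toReal) (μ : Measure X) := by
  simp only [fun x => toReal_dualEntropy (hf x)]
  exact (f.integrable _).inf (integrable_const a)

end GenWasserstein

/-- Kantorovich duality for `W_1^{a,b}`. The first conjunct says that the primal value is finite, the
second that, for admissible pairs, the integrands `I(φᵢ(x))` are real numbers and integrable, and the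
third that `W_1^{a,b}(μ₁, μ₂)` is the supremum of the dual values. -/
theorem mainTheorem1 {X : Type*} [MetricSpace X] [CompleteSpace X]
    [TopologicalSpace.SeparableSpace X] [MeasurableSpace X] [BorelSpace X]
    (a b : ℝ) (ha : 0 < a) (hb : 0 < b) (μ₁ μ₂ : FiniteMeasure X) :
    GenWasserstein.genWasserstein 1 a b μ₁ μ₂ ≠ ∞ ∧
    (∀ φ ∈ GenWasserstein.dualPairs X a b,
      (∀ x, ∃ r : ℝ, GenWasserstein.dualEntropy a (φ.1 x) = (r : EReal)) ∧
      (∀ x, ∃ r : ℝ, GenWasserstein.dualEntropy a (φ.2 x) = (r : EReal)) ∧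
      Integrable (fun x => (GenWasserstein.dualEntropy a (φ.1 x)).toReal) (μ₁ : Measure X) ∧
      Integrable (fun x => (GenWasserstein.dualEntropy a (φ.2 x)).toReal) (μ₂ : Measure X)) ∧
    IsLUB (GenWasserstein.dualValue a μ₁ μ₂ '' GenWasserstein.dualPairs X a b)
      (GenWasserstein.genWasserstein 1 a b μ₁ μ₂).toReal := by
  have hfin := GenWasserstein.genWasserstein_one_ne_top a b μ₁ μ₂
  refine ⟨hfin, fun φ hφ => ?_, ?_, fun B hB => ?_⟩
  · have h₁ : ∀ x, -a ≤ φ.1 x := fun x => (hφ x x).2.1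
    have h₂ : ∀ x, -a ≤ φ.2 x := fun x => (hφ x x).2.2
    exact ⟨fun x => GenWasserstein.exists_dualEntropy_eq_coe (h₁ x),
      fun x => GenWasserstein.exists_dualEntropy_eq_coe (h₂ x),
      GenWasserstein.integrable_dualEntropy h₁ μ₁, GenWasserstein.integrable_dualEntropy h₂ μ₂⟩
  · rintro _ ⟨φ, hφ, rfl⟩
    exact (ENNReal.ofReal_le_iff_le_toReal hfin).1
      (GenWasserstein.ofReal_dualValue_le_genWasserstein ha hb μ₁ μ₂ hφ)
  · set C := b * ((μ₁ : Measure X).real univ + 3 * (μ₂ : Measure X).real univ) + 4 * a with hC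
    have hC_pos : 0 < C := by positivity
    refine le_of_forall_pos_le_add fun ε hε => ?_
    obtain ⟨φ, hφ, h⟩ := GenWasserstein.exists_dualPair_genWasserstein_le ha hb μ₁ μ₂
      (div_pos hε hC_pos)
    rw [← hC, mul_div_cancel₀ _ hC_pos.ne'] at h
    linarith [hB (mem_image_of_mem _ hφ)]
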